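/- Let $M$ be a compact topological manifold (without boundary) of dimension $\ge 2$, with a metric $d$ inducing its topology, and let $\mathrm{Hom}(M)$ be the space of homeomorphisms of $M$ with the metric $d_{C^0}(f,g)=\max_{x\in M} d(f(x),g(x))$. For $f\in \mathrm{Hom}(M)$, a continuous strict Lyapunov function for $f$ is a continuous $u:M\to\mathbb{R}$ with $u(f(x))\le u(x)$ for all $x\in M$ and $u(f(x))<u(x)$ for some $x\in M$. The generalized recurrent set $\mathcal{GR}(f)$ is the set of $x\in M$ such that, for every metric $\delta$ on $M$ compatible with the topology and every $\varepsilon>0$, there are $n\ge 1$ and points $x_1=x,x_2,\dots,x_n,x_{n+1}=x$ with $\sum_{i=1}^n \delta(f(x_i),x_{i+1})<\varepsilon$. A decomposition of $\mathcal{GR}(f)$ is a finite family $L_1,\dots,L_k$ of pairwise disjoint compact sets with $f(L_i)=L_i$ and $\mathcal{GR}(f)=\bigcup_{i=1}^k L_i$. For a compact invariant set $L$ put $W^s(L)=\{x: d(f^m(x),L)\to 0 \text{ as } m\to+\infty\}$ and $W^u(L)=\{x: d(f^{-m}(x),L)\to 0 \text{ as } m\to+\infty\}$. Write $L_i\rightharpoonup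 L_j$ if $(W^u(L_i)\cap W^s(L_j))\setminus\mathcal{GR}(f)\neq\emptyset$. The decomposition is without cycles if there are no $r\ge 1$ and distinct indices $i_1,\dots,i_r$ with $L_{i_1}\rightharpoonup L_{i_2}\rightharpoonup\cdots\rightharpoonup L_{i_r}\rightharpoonup L_{i_1}$ (for $r=1$: $L_{i_1}\rightharpoonup L_{i_1}$). **Proposition.** Let $f\in \mathrm{Hom}(M)$ admit a continuous strict Lyapunov function. If there exists a decomposition of $\mathcal{GR}(f)$ without cycles, then there exists a neighborhood $V$ of $f$ in $\mathrm{Hom}(M)$ such that every $g\in V$ admits a continuous strict Lyapunov function. -/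

import Mathlib

open Set Filter Topology

namespace GenRec

/-- The metric `d(f,g) = max_x d(f x, g x)` on the homeomorphisms of a compact metric space,
obtained from the sup metric on `C(X, X)`; see `dist_homeo_eq_iSup`. -/
noncomputable instance homeoMetricSpace {X : Type*} [MetricSpace X] [CompactSpace X] :
    MetricSpace (X ≃ₜ X) :=
  MetricSpace.induced (fun f => (⟨f, f.continuous⟩ : C(X, X)))
    (fun _ _ h => Homeomorph.ext (fun x => DFunLike.congr_fun h x)) inferInstance

theorem dist_homeo_eq_iSup {X : Type*} [MetricSpace X] [CompactSpace X] (f g : X ≃ₜ X) :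
    dist f g = ⨆ x, dist (f x) (g x) :=
  ContinuousMap.dist_eq_iSup (f := (⟨f, f.continuous⟩ : C(X, X)))
    (g := (⟨g, g.continuous⟩ : C(X, X)))

/-- There is a strong `ε`-chain from `a` to `b`: points `x 0 = a, …, x (n - 1)` with `n ≥ 1` such
that, with `x n = b`, the sum of the jumps `d(f (x i), x (i + 1))`, `i < n`, is less than `ε`.
(The values of `x` beyond `n` are irrelevant.) -/
def HasStrongChain {X : Type*} [MetricSpace X] (f : X → X) (ε : ℝ) (a b : X) : Prop :=
  ∃ (n : ℕ) (x : ℕ → X), 1 ≤ n ∧ x 0 = a ∧ x n = b ∧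
    ∑ i ∈ Finset.range n, dist (f (x i)) (x (i + 1)) < ε

/-- The strong chain recurrent set of `f` with respect to the given metric. -/
def strongChainRecurrentSet {X : Type*} [MetricSpace X] (f : X → X) : Set X :=
  {x | ∀ ε : ℝ, 0 < ε → HasStrongChain f ε x x}

/-- The generalized recurrent set: the intersection of the strong chain recurrent sets over all
metrics on `X` that induce the given topology of `X`. -/
def generalizedRecurrentSet {X : Type*} [t : TopologicalSpace X] (f : X ≃ₜ X) : Set X :=
  {x | ∀ d : MetricSpace X, d.toUniformSpace.toTopologicalSpace = t →
    x ∈ @strongChainRecurrentSet X d f}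

/-- `u` is a continuous Lyapunov function for `f`. -/
def IsContinuousLyapunov {X : Type*} [TopologicalSpace X] (f : X ≃ₜ X) (u : X → ℝ) : Prop :=
  Continuous u ∧ ∀ x, u (f x) ≤ u x

/-- `u` is a continuous strict Lyapunov function for `f`: one that is not a first integral. -/
def IsContinuousStrictLyapunov {X : Type*} [TopologicalSpace X] (f : X ≃ₜ X) (u : X → ℝ) : Prop :=
  IsContinuousLyapunov f u ∧ ∃ x, u (f x) < u x

/-- The stable set of `L`: points with `d(f^k x, L) → 0` as `k → +∞`. The distance to a set is
taken in `[0, ∞]`, so that the distance to the empty set is `∞` and its stable set is empty. -/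
def stableSet {X : Type*} [MetricSpace X] (f : X ≃ₜ X) (L : Set X) : Set X :=
  {x | Tendsto (fun k : ℕ => Metric.infEDist (f^[k] x) L) atTop (𝓝 0)}

/-- The unstable set of `L`: points with `d(f^{-k} x, L) → 0` as `k → +∞`. -/
def unstableSet {X : Type*} [MetricSpace X] (f : X ≃ₜ X) (L : Set X) : Set X :=
  {x | Tendsto (fun k : ℕ => Metric.infEDist (f.symm^[k] x) L) atTop (𝓝 0)}

/-- `L 0, …, L (k - 1)` is a decomposition of the generalized recurrent set of `f`. -/
structure IsDecomposition {X : Type*} [TopologicalSpace X] (f : X ≃ₜ X) {k : ℕ}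
    (L : Fin k → Set X) : Prop where
  isCompact : ∀ i, IsCompact (L i)
  invariant : ∀ i, f '' L i = L i
  pairwise_disjoint : ∀ i j, i ≠ j → Disjoint (L i) (L j)
  iUnion_eq : generalizedRecurrentSet f = ⋃ i, L i

/-- `A ⇀ B`: some point outside the generalized recurrent set has an orbit going from `A` to
`B`. -/
def Arrow {X : Type*} [MetricSpace X] (f : X ≃ₜ X) (A B : Set X) : Prop :=
  ((unstableSet f A ∩ stableSet f B) \ generalizedRecurrentSet f).Nonempty

/-- `L (σ 0), …, L (σ (r - 1))` form an `r`-cycle, `r ≥ 1`: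
`L (σ 0) ⇀ L (σ 1) ⇀ … ⇀ L (σ (r - 1)) ⇀ L (σ 0)` (`finRotate r` is the cyclic successor). -/
def IsCycle {X : Type*} [MetricSpace X] (f : X ≃ₜ X) {k : ℕ} (L : Fin k → Set X) (r : ℕ)
    (σ : Fin r → Fin k) : Prop :=
  1 ≤ r ∧ ∀ j : Fin r, Arrow f (L (σ j)) (L (σ (finRotate r j)))

/-- No members of the family `L` form a cycle. -/
def HasNoCycles {X : Type*} [MetricSpace X] (f : X ≃ₜ X) {k : ℕ} (L : Fin k → Set X) : Prop :=
  ∀ (r : ℕ) (σ : Fin r → Fin k), Function.Injective σ → ¬ IsCycle f L r σ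

end GenRec

/-! Some point lies outside `GR(f)`, so it joins two members of the decomposition by an arrow, and
since there are no cycles some member `L c` has an incoming arrow but no outgoing one. A backward
orbit that stays near `L c` accumulates on `L c` only, hence would start an outgoing arrow unless it
lies in `L c`. So `L c` is the largest set with backward orbits in one of its neighborhoods, and
therefore has a compact neighborhood `C` carried by the iterates of `f` into any prescribed
neighborhood of `L c`. The incoming arrow shows that `L c` is not open, so some `q ∈ C` is not in
`L c`, and `f^m(C) ⊆ interior C \ {q}` for some `m`. This is an open condition on `f`. If `g`
satisfies it, a Urysohn function `v` that is `0` on `g^m(C)` and `1` off `interior C \ {q}` is a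
strict Lyapunov function for `g^m`, and `v + v ∘ g + ⋯ + v ∘ g^(m-1)` is one for `g`. -/

namespace GenRec

open scoped Function

section Recurrence

theorem exists_compatible_metricSpace_lipschitzWith_one {X : Type*} [t : TopologicalSpace X]
    [TopologicalSpace.MetrizableSpace X] {u : X → ℝ} (hu : Continuous u) :
    ∃ d : MetricSpace X, d.toUniformSpace.toTopologicalSpace = t ∧ LipschitzWith 1 u := by
  let := TopologicalSpace.metrizableSpaceMetric X
  let graph : X → X × ℝ := fun y => (y, u y)
  have hinj : Function.Injective graph := fun _ _ hab => congrArg Prod.fst hab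
  have hind : IsInducing graph :=
    IsInducing.of_comp (continuous_id.prodMk hu) continuous_fst IsInducing.id
  refine ⟨MetricSpace.induced graph hinj inferInstance, hind.eq_induced.symm, ?_⟩
  exact @LipschitzWith.mk_one X ℝ (MetricSpace.induced graph hinj inferInstance).toPseudoMetricSpace
    _ u fun a b => le_max_right (dist a b) (dist (u a) (u b))

theorem HasStrongChain.sub_lt {X : Type*} [MetricSpace X] {f : X → X} {u : X → ℝ}
    (hlip : LipschitzWith 1 u) (hu : ∀ x, u (f x) ≤ u x) {ε : ℝ} {a b : X}
    (h : HasStrongChain f ε a b) : u b - u (f a) < ε := by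
  obtain ⟨n, x, hn, rfl, rfl, hsum⟩ := h
  have hjump : ∀ i, u (x (i + 1)) - u (f (x i)) ≤ dist (f (x i)) (x (i + 1)) := fun i => by
    have := hlip.dist_le_mul (x (i + 1)) (f (x i))
    rw [NNReal.coe_one, one_mul, dist_comm (x _)] at this
    exact (le_abs_self _).trans this
  have hfirst : u (x 0) - u (f (x 0)) ≤ ∑ i ∈ Finset.range n, (u (x i) - u (f (x i))) :=
    Finset.single_le_sum (f := fun i => u (x i) - u (f (x i)))
      (fun i _ => sub_nonneg.2 (hu (x i))) (Finset.mem_range.2 hn)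
  calc u (x n) - u (f (x 0))
      = ∑ i ∈ Finset.range n, (u (x (i + 1)) - u (x i)) + (u (x 0) - u (f (x 0))) := by
        rw [Finset.sum_range_sub fun i => u (x i)]; ring
    _ ≤ ∑ i ∈ Finset.range n, (u (x (i + 1)) - u (x i))
        + ∑ i ∈ Finset.range n, (u (x i) - u (f (x i))) := by gcongr
    _ = ∑ i ∈ Finset.range n, (u (x (i + 1)) - u (f (x i))) := by
        rw [← Finset.sum_add_distrib]; simp only [sub_add_sub_cancel]
    _ ≤ ∑ i ∈ Finset.range n, dist (f (x i)) (x (i + 1)) := Finset.sum_le_sum fun i _ => hjump i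
    _ < ε := hsum

theorem IsContinuousLyapunov.notMem_generalizedRecurrentSet {X : Type*} [TopologicalSpace X]
    [TopologicalSpace.MetrizableSpace X] {f : X ≃ₜ X} {u : X → ℝ} (hu : IsContinuousLyapunov f u)
    {x : X} (hx : u (f x) < u x) : x ∉ generalizedRecurrentSet f := by
  intro hrec
  obtain ⟨d, hd, hlip⟩ := exists_compatible_metricSpace_lipschitzWith_one hu.1
  exact lt_irrefl _ ((hrec d hd _ (sub_pos.2 hx)).sub_lt hlip hu.2)

/-- The nonwandering set of `h`: the points every neighborhood of which meets one of its images
under the positive iterates of `h`. It links limit points of orbits to generalized recurrence. -/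
def nonwanderingSet {X : Type*} [TopologicalSpace X] (h : X → X) : Set X :=
  {y | ∀ V ∈ 𝓝 y, ∃ m ≥ 1, ∃ z ∈ V, h^[m] z ∈ V}

theorem mem_nonwanderingSet_of_mapClusterPt_iterate {X : Type*} [TopologicalSpace X] {h : X → X}
    {x y : X} (hy : MapClusterPt y atTop (h^[·] x)) : y ∈ nonwanderingSet h := by
  intro V hV
  have hfreq := frequently_atTop.1 (hy.frequently hV)
  obtain ⟨a, -, ha⟩ := hfreq 0
  obtain ⟨b, hab, hb⟩ := hfreq (a + 1)
  refine ⟨b - a, by omega, h^[a] x, ha, ?_⟩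
  rwa [← Function.iterate_add_apply, Nat.sub_add_cancel (by omega)]

theorem nonwanderingSet_symm_subset {X : Type*} [TopologicalSpace X] (f : X ≃ₜ X) :
    nonwanderingSet f.symm ⊆ nonwanderingSet f := by
  intro y hy V hV
  obtain ⟨m, hm, z, hz, hmz⟩ := hy V hV
  have hinv : f^[m] (f.symm^[m] z) = z := Function.LeftInverse.iterate f.apply_symm_apply m z
  exact ⟨m, hm, f.symm^[m] z, hmz, hinv.symm ▸ hz⟩

theorem hasStrongChain_of_iterate {X : Type*} [MetricSpace X] {f : X → X} {y z : X} {m : ℕ}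
    (hm : 1 ≤ m) {ε : ℝ} (h : dist (f y) (f z) + dist (f^[m] z) y < ε) :
    HasStrongChain f ε y y := by
  obtain ⟨p, rfl⟩ : ∃ p, m = p + 1 := ⟨m - 1, by omega⟩
  let x : ℕ → X := fun i => if i = 0 ∨ i = p + 1 then y else f^[i] z
  refine ⟨p + 1, x, hm, if_pos (Or.inl rfl), if_pos (Or.inr rfl), lt_of_le_of_lt ?_ h⟩
  have hstart : ∀ i ∈ Finset.range (p + 1),
      dist (f (x i)) (f^[i + 1] z) = if i = 0 then dist (f y) (f z) else 0 := fun i hi => by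
    rw [Function.iterate_succ_apply']
    rcases eq_or_ne i 0 with rfl | hi0
    · simp [x]
    · simp [x, hi0, (Finset.mem_range.1 hi).ne]
  have hend : ∀ i, dist (f^[i + 1] z) (x (i + 1)) = if i = p then dist (f^[p + 1] z) y else 0 :=
    fun i => by
      rcases eq_or_ne i p with rfl | hip
      · simp [x]
      · simp [x, hip]
  calc ∑ i ∈ Finset.range (p + 1), dist (f (x i)) (x (i + 1))
      ≤ ∑ i ∈ Finset.range (p + 1),
          (dist (f (x i)) (f^[i + 1] z) + dist (f^[i + 1] z) (x (i + 1))) :=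
        Finset.sum_le_sum fun i _ => dist_triangle _ _ _
    _ = dist (f y) (f z) + dist (f^[p + 1] z) y := by
        rw [Finset.sum_add_distrib, Finset.sum_congr rfl hstart,
          Finset.sum_congr rfl fun i _ => hend i]
        simp

theorem nonwanderingSet_subset_generalizedRecurrentSet {X : Type*} [TopologicalSpace X]
    (f : X ≃ₜ X) : nonwanderingSet f ⊆ generalizedRecurrentSet f := by
  rintro y hy d rfl ε hε
  have hV : f ⁻¹' Metric.ball (f y) (ε / 2) ∩ Metric.ball y (ε / 2) ∈ 𝓝 y :=
    inter_mem (f.continuous.continuousAt (Metric.ball_mem_nhds _ (half_pos hε)))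
      (Metric.ball_mem_nhds _ (half_pos hε))
  obtain ⟨m, hm, z, ⟨hfz, -⟩, ⟨-, hmz⟩⟩ := hy _ hV
  refine hasStrongChain_of_iterate (z := z) hm ?_
  calc dist (f y) (f z) + dist (f^[m] z) y < ε / 2 + ε / 2 :=
        add_lt_add (Metric.mem_ball'.1 hfz) (Metric.mem_ball.1 hmz)
    _ = ε := add_halves ε

theorem mem_generalizedRecurrentSet_of_mapClusterPt {X : Type*} [TopologicalSpace X] {f : X ≃ₜ X}
    {x y : X} (hy : MapClusterPt y atTop (f^[·] x)) : y ∈ generalizedRecurrentSet f :=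
  nonwanderingSet_subset_generalizedRecurrentSet f (mem_nonwanderingSet_of_mapClusterPt_iterate hy)

theorem mem_generalizedRecurrentSet_of_mapClusterPt_symm {X : Type*} [TopologicalSpace X]
    {f : X ≃ₜ X} {x y : X} (hy : MapClusterPt y atTop (f.symm^[·] x)) :
    y ∈ generalizedRecurrentSet f :=
  nonwanderingSet_subset_generalizedRecurrentSet f
    (nonwanderingSet_symm_subset f (mem_nonwanderingSet_of_mapClusterPt_iterate hy))

end Recurrence

section Convergence

theorem tendsto_iterate_nhdsSet_of_union {X : Type*} [TopologicalSpace X] {h : X → X}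
    (hh : Continuous h) {P Q : Set X} (hPQ : Disjoint (𝓝ˢ P) (𝓝ˢ Q)) (hP : MapsTo h P P) {x y : X}
    (hx : Tendsto (h^[·] x) atTop (𝓝ˢ (P ∪ Q))) (hyP : y ∈ P)
    (hy : MapClusterPt y atTop (h^[·] x)) : Tendsto (h^[·] x) atTop (𝓝ˢ P) := by
  obtain ⟨A, hA, B, hB, hAB⟩ := Filter.disjoint_iff.1 hPQ
  intro V hV
  -- The orbit cannot jump from `W` to `B`, because `h` maps `W` into `A`.
  let W : Set X := V ∩ h ⁻¹' A
  have hW : W ∈ 𝓝ˢ P := inter_mem hV (hh.tendsto_nhdsSet hP hA)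
  have hWB : W ∪ B ∈ 𝓝ˢ (P ∪ Q) := union_mem_nhdsSet hW hB
  obtain ⟨N, hN⟩ := eventually_atTop.1 (hx.eventually hWB)
  obtain ⟨a, haN, ha⟩ := frequently_atTop.1 (hy.frequently (nhds_le_nhdsSet hyP hW)) N
  have hstay : ∀ n ≥ a, h^[n] x ∈ W := fun n hn => by
    induction n, hn using Nat.le_induction with
    | base => exact ha
    | succ n hn ih =>
      refine (hN (n + 1) (by omega)).resolve_right (disjoint_left.1 hAB ?_)
      rw [Function.iterate_succ_apply']
      exact ih.2
  exact eventually_atTop.2 ⟨a, fun n hn => (hstay n hn).1⟩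

theorem separatedNhds_biUnion_compl_singleton {X ι : Type*} [TopologicalSpace X] [T2Space X]
    [Finite ι] {L : ι → Set X} (hL : ∀ i, IsCompact (L i)) (hdisj : Pairwise (Disjoint on L))
    (i : ι) : SeparatedNhds (L i) (⋃ j ∈ ({i}ᶜ : Set ι), L j) :=
  .of_isCompact_isCompact (hL i) ((toFinite _).isCompact_biUnion fun j _ => hL j)
    (disjoint_iUnion₂_right.2 fun _ hj => hdisj (Ne.symm hj))

theorem exists_tendsto_iterate_nhdsSet {X ι : Type*} [TopologicalSpace X] [CompactSpace X]
    [T2Space X] [Finite ι] {h : X → X} (hh : Continuous h) {L : ι → Set X}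
    (hL : ∀ i, IsCompact (L i)) (hdisj : Pairwise (Disjoint on L))
    (hmaps : ∀ i, MapsTo h (L i) (L i)) {x : X}
    (hx : ∀ y, MapClusterPt y atTop (h^[·] x) → y ∈ ⋃ i, L i) :
    ∃ i, Tendsto (h^[·] x) atTop (𝓝ˢ (L i)) := by
  obtain ⟨y, -, hy⟩ := isCompact_univ.exists_mapClusterPt (f := atTop) (u := (h^[·] x)) (by simp)
  obtain ⟨i, hi⟩ := mem_iUnion.1 (hx y hy)
  refine ⟨i, tendsto_iterate_nhdsSet_of_union hh
    (separatedNhds_biUnion_compl_singleton hL hdisj i).disjoint_nhdsSet (hmaps i) ?_ hi hy⟩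
  rw [← biUnion_insert, insert_eq, union_compl_self, biUnion_univ]
  exact isCompact_univ.tendsto_nhdsSet_of_mapClusterPt (Eventually.of_forall fun _ => mem_univ _)
    fun y _ => hx y

theorem mem_stableSet_iff_tendsto_nhdsSet {X : Type*} [MetricSpace X] {f : X ≃ₜ X} {L : Set X}
    (hL : IsCompact L) {x : X} : x ∈ stableSet f L ↔ Tendsto (f^[·] x) atTop (𝓝ˢ L) := by
  refine ⟨fun hx => (Metric.hasBasis_nhdsSet_thickening hL).tendsto_right_iff.2 fun ε hε => ?_,
    fun hx => ?_⟩
  · exact (Tendsto.eventually_lt_const (ENNReal.ofReal_pos.2 hε) hx :)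
  · have hzero : Tendsto (Metric.infEDist · L) (𝓝ˢ L) (𝓝 0) :=
      nhdsSet_singleton (x := (0 : ENNReal)) ▸ Metric.continuous_infEDist.tendsto_nhdsSet
        fun _ => Metric.infEDist_zero_of_mem
    exact hzero.comp hx

theorem mem_unstableSet_iff_tendsto_nhdsSet {X : Type*} [MetricSpace X] {f : X ≃ₜ X} {L : Set X}
    (hL : IsCompact L) {x : X} : x ∈ unstableSet f L ↔ Tendsto (f.symm^[·] x) atTop (𝓝ˢ L) :=
  mem_stableSet_iff_tendsto_nhdsSet (f := f.symm) hL

end Convergence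

section Attractors

/-- Some compact neighborhood of `L` is carried into every neighborhood of `L` by all large iterates
of `f`. A compact invariant set with this property is an attractor; invariance and compactness of
`L` are not part of the definition. -/
def IsUniformlyAttracting {X : Type*} [TopologicalSpace X] (f : X → X) (L : Set X) : Prop :=
  ∃ C ∈ 𝓝ˢ L, IsCompact C ∧ ∀ W ∈ 𝓝ˢ L, ∀ᶠ n in atTop, MapsTo f^[n] C W

/-- The points whose first `n` backward iterates stay in `N`, that is, the intersection of the
images `f^j(N)` for `j ≤ n`. As `n` grows these sets shrink to the maximal subset of `N` that is
invariant under `f⁻¹`. -/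
def backwardStaySet {X : Type*} [TopologicalSpace X] (f : X ≃ₜ X) (N : Set X) (n : ℕ) : Set X :=
  {x | ∀ j ≤ n, f.symm^[j] x ∈ N}

section BackwardStaySet

variable {X : Type*} [TopologicalSpace X] {f : X ≃ₜ X} {L N : Set X}

theorem backwardStaySet_antitone (f : X ≃ₜ X) (N : Set X) : Antitone (backwardStaySet f N) :=
  fun _ _ hab _ hx j hj => hx j (hj.trans hab)

theorem isClosed_backwardStaySet (f : X ≃ₜ X) (hN : IsClosed N) (n : ℕ) :
    IsClosed (backwardStaySet f N n) := by
  simp only [backwardStaySet, ofPred_forall]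
  exact isClosed_biInter fun j _ => hN.preimage (f.symm.continuous.iterate j)

theorem backwardStaySet_mem_nhdsSet (hL : MapsTo f.symm L L) (hN : N ∈ 𝓝ˢ L) (n : ℕ) :
    backwardStaySet f N n ∈ 𝓝ˢ L :=
  (eventually_all_finite (finite_Iic n)).2 fun j _ =>
    (f.symm.continuous.iterate j).tendsto_nhdsSet (hL.iterate j) hN

theorem mapsTo_iterate_backwardStaySet {n : ℕ} (h : MapsTo f (backwardStaySet f N n) N) (m : ℕ) :
    MapsTo f^[m] (backwardStaySet f N n) (backwardStaySet f N (m + n)) := by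
  intro x hx
  induction m with
  | zero => simpa using hx
  | succ m ih =>
    rw [Function.iterate_succ_apply']
    rintro (_ | j) hj
    · exact h (backwardStaySet_antitone f N (Nat.le_add_left n m) ih)
    · rw [Function.iterate_succ_apply, f.symm_apply_apply]
      exact ih j (by omega)

theorem exists_backwardStaySet_subset [CompactSpace X] (hN : IsClosed N)
    (hmax : ∀ x, (∀ n : ℕ, f.symm^[n] x ∈ N) → x ∈ L) {W : Set X} (hW : W ∈ 𝓝ˢ L) :
    ∃ n, backwardStaySet f N n ⊆ W :=
  exists_subset_nhds_of_isCompact' (backwardStaySet_antitone f N).directed_ge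
    (fun n => (isClosed_backwardStaySet f hN n).isCompact) (isClosed_backwardStaySet f hN)
    fun x hx => mem_nhdsSet_iff_forall.1 hW x (hmax x fun n => mem_iInter.1 hx n n le_rfl)

theorem isUniformlyAttracting_of_forall_symm_iterate_mem [CompactSpace X] (hf : MapsTo f L L)
    (hf' : MapsTo f.symm L L) (hN : IsClosed N) (hNL : N ∈ 𝓝ˢ L)
    (hmax : ∀ x, (∀ n : ℕ, f.symm^[n] x ∈ N) → x ∈ L) : IsUniformlyAttracting f L := by
  obtain ⟨n, hn⟩ := exists_backwardStaySet_subset hN hmax (f.continuous.tendsto_nhdsSet hf hNL)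
  refine ⟨backwardStaySet f N n, backwardStaySet_mem_nhdsSet hf' hNL n,
    (isClosed_backwardStaySet f hN n).isCompact, fun W hW => ?_⟩
  obtain ⟨p, hp⟩ := exists_backwardStaySet_subset hN hmax hW
  filter_upwards [eventually_ge_atTop p] with m hm
  exact (mapsTo_iterate_backwardStaySet hn m).mono_right
    ((backwardStaySet_antitone f N (hm.trans (Nat.le_add_right m n))).trans hp)

end BackwardStaySet

theorem not_isOpen_of_tendsto_iterate_nhdsSet {X : Type*} [TopologicalSpace X] {f : X ≃ₜ X}
    {L : Set X} (hL : MapsTo f.symm L L) {y : X} (hy : Tendsto (f^[·] y) atTop (𝓝ˢ L))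
    (hyL : y ∉ L) : ¬ IsOpen L := by
  intro hopen
  obtain ⟨n, hn⟩ := (hy.eventually hopen.mem_nhdsSet_self).exists
  exact hyL (Function.LeftInverse.iterate f.symm_apply_apply n y ▸ hL.iterate n hn)

end Attractors

section Stability

theorem isContinuousStrictLyapunov_birkhoffSum {X : Type*} [TopologicalSpace X] {g : X ≃ₜ X}
    {v : X → ℝ} (hv : Continuous v) {m : ℕ} (hle : ∀ x, v (g^[m] x) ≤ v x) {q : X}
    (hlt : v (g^[m] q) < v q) : IsContinuousStrictLyapunov g (birkhoffSum g v m) := by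
  have hdiff := birkhoffSum_apply_sub_birkhoffSum g v m
  refine ⟨⟨continuous_finsetSum _ fun i _ => hv.comp (g.continuous.iterate i), fun x => ?_⟩, q, ?_⟩
  · exact sub_nonpos.1 (hdiff x ▸ sub_nonpos.2 (hle x))
  · exact sub_neg.1 (hdiff q ▸ sub_neg.2 hlt)

theorem exists_isContinuousStrictLyapunov_of_mapsTo_iterate {X : Type*} [TopologicalSpace X]
    [T4Space X] {g : X ≃ₜ X} {C U : Set X} (hC : IsCompact C) (hU : IsOpen U) (hUC : U ⊂ C) {m : ℕ}
    (hm : MapsTo g^[m] C U) : ∃ u : X → ℝ, IsContinuousStrictLyapunov g u := by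
  obtain ⟨v, hv0, hv1, hv⟩ := exists_continuous_zero_one_of_isClosed
    (hC.image (g.continuous.iterate m)).isClosed hU.isClosed_compl
    (disjoint_compl_right_iff_subset.2 hm.image_subset)
  obtain ⟨q, hqC, hqU⟩ := exists_of_ssubset hUC
  refine ⟨_, isContinuousStrictLyapunov_birkhoffSum v.continuous (m := m) (q := q) (fun x => ?_) ?_⟩
  · by_cases hx : x ∈ C
    · exact (hv0 (mem_image_of_mem _ hx)).trans_le (hv x).1
    · exact (hv _).2.trans_eq (hv1 fun hxU => hx (hUC.subset hxU)).symm
  · rw [hv0 (mem_image_of_mem _ hqC), hv1 hqU]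
    exact zero_lt_one

theorem continuous_iterate_continuousMap {X : Type*} [MetricSpace X] [CompactSpace X] (m : ℕ) :
    Continuous fun g : X ≃ₜ X => (⟨g^[m], g.continuous.iterate m⟩ : C(X, X)) := by
  have hcoe : Continuous fun g : X ≃ₜ X => (⟨g, g.continuous⟩ : C(X, X)) := continuous_induced_dom
  induction m with
  | zero => exact continuous_const (y := ContinuousMap.id X)
  | succ m ih => exact ih.compCM hcoe

theorem eventually_mapsTo_iterate {X : Type*} [MetricSpace X] [CompactSpace X] {f : X ≃ₜ X}
    {C U : Set X} (hC : IsCompact C) (hU : IsOpen U) {m : ℕ} (hm : MapsTo f^[m] C U) :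
    ∀ᶠ g : X ≃ₜ X in 𝓝 f, MapsTo g^[m] C U :=
  (continuous_iterate_continuousMap m).continuousAt.eventually
    ((ContinuousMap.isOpen_setOfPred_mapsTo hC hU).mem_nhds hm)

theorem IsUniformlyAttracting.eventually_exists_isContinuousStrictLyapunov {X : Type*}
    [MetricSpace X] [CompactSpace X] {f : X ≃ₜ X} {L : Set X} (h : IsUniformlyAttracting f L)
    (hL : ¬ IsOpen L) : ∀ᶠ g in 𝓝 f, ∃ u : X → ℝ, IsContinuousStrictLyapunov g u := by
  obtain ⟨C, hCL, hC, hattr⟩ := h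
  obtain ⟨q, hqC, hqL⟩ : ∃ q ∈ C, q ∉ L := by
    by_contra! hsub
    exact hL (isOpen_iff_mem_nhds.2 fun x hx =>
      mem_of_superset (mem_nhdsSet_iff_forall.1 hCL x hx) hsub)
  let U : Set X := interior C \ {q}
  have hU : IsOpen U := isOpen_interior.sdiff isClosed_singleton
  have hLU : U ∈ 𝓝ˢ L := hU.mem_nhdsSet.2
    (subset_sdiff_singleton (subset_interior_iff_mem_nhdsSet.2 hCL) hqL)
  have hUC : U ⊂ C :=
    (ssubset_iff_of_subset (sdiff_subset.trans interior_subset)).2 ⟨q, hqC, fun hq => hq.2 rfl⟩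
  obtain ⟨m, hm⟩ := (hattr U hLU).exists
  filter_upwards [eventually_mapsTo_iterate hC hU hm] with g hg
  exact exists_isContinuousStrictLyapunov_of_mapsTo_iterate hC hU hUC hg

end Stability

namespace IsDecomposition

section Topological

variable {X : Type*} [TopologicalSpace X] {f : X ≃ₜ X} {k : ℕ} {L : Fin k → Set X}

theorem mapsTo (h : IsDecomposition f L) (i : Fin k) : MapsTo f (L i) (L i) :=
  mapsTo_iff_image_subset.2 (h.invariant i).subset

theorem mapsTo_symm (h : IsDecomposition f L) (i : Fin k) : MapsTo f.symm (L i) (L i) := by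
  intro x hx
  rw [← h.invariant i] at hx
  obtain ⟨z, hz, rfl⟩ := hx
  rwa [f.symm_apply_apply]

theorem pairwise_disjoint_on (h : IsDecomposition f L) : Pairwise (Disjoint on L) :=
  fun i j => h.pairwise_disjoint i j

theorem subset_generalizedRecurrentSet (h : IsDecomposition f L) (i : Fin k) :
    L i ⊆ generalizedRecurrentSet f :=
  h.iUnion_eq ▸ subset_iUnion L i

theorem exists_isClosed_nhdsSet_inter_subset [T2Space X] (h : IsDecomposition f L) (c : Fin k) :
    ∃ N ∈ 𝓝ˢ (L c), IsClosed N ∧ N ∩ generalizedRecurrentSet f ⊆ L c := by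
  obtain ⟨A, B, hA, hB, hcA, hB_others, hAB⟩ :=
    separatedNhds_biUnion_compl_singleton h.isCompact h.pairwise_disjoint_on c
  refine ⟨Bᶜ, mem_of_superset (hA.mem_nhdsSet.2 hcA) hAB.subset_compl_right,
    hB.isClosed_compl, ?_⟩
  rintro y ⟨hyB, hy⟩
  obtain ⟨j, hj⟩ := mem_iUnion.1 (h.iUnion_eq ▸ hy)
  rcases eq_or_ne j c with rfl | hjc
  · exact hj
  · exact absurd (hB_others (mem_biUnion hjc hj)) hyB

end Topological

theorem not_isOpen_of_arrow {X : Type*} [MetricSpace X] {f : X ≃ₜ X} {k : ℕ}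
    {L : Fin k → Set X} (h : IsDecomposition f L) {i j : Fin k}
    (hij : Arrow f (L i) (L j)) : ¬ IsOpen (L j) := by
  obtain ⟨y, ⟨-, hy⟩, hyrec⟩ := hij
  exact not_isOpen_of_tendsto_iterate_nhdsSet (h.mapsTo_symm j)
    ((mem_stableSet_iff_tendsto_nhdsSet (h.isCompact j)).1 hy)
    fun hyj => hyrec (h.subset_generalizedRecurrentSet j hyj)

section CompactMetric

variable {X : Type*} [MetricSpace X] [CompactSpace X] {f : X ≃ₜ X} {k : ℕ} {L : Fin k → Set X}

theorem exists_mem_stableSet (h : IsDecomposition f L) (x : X) : ∃ i, x ∈ stableSet f (L i) := by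
  obtain ⟨i, hi⟩ := exists_tendsto_iterate_nhdsSet (x := x) f.continuous h.isCompact
    h.pairwise_disjoint_on h.mapsTo
    fun _ hy => h.iUnion_eq ▸ mem_generalizedRecurrentSet_of_mapClusterPt hy
  exact ⟨i, (mem_stableSet_iff_tendsto_nhdsSet (h.isCompact i)).2 hi⟩

theorem exists_mem_unstableSet (h : IsDecomposition f L) (x : X) :
    ∃ i, x ∈ unstableSet f (L i) := by
  obtain ⟨i, hi⟩ := exists_tendsto_iterate_nhdsSet (x := x) f.symm.continuous h.isCompact
    h.pairwise_disjoint_on h.mapsTo_symm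
    fun _ hy => h.iUnion_eq ▸ mem_generalizedRecurrentSet_of_mapClusterPt_symm hy
  exact ⟨i, (mem_unstableSet_iff_tendsto_nhdsSet (h.isCompact i)).2 hi⟩

theorem exists_arrow (h : IsDecomposition f L) {x : X} (hx : x ∉ generalizedRecurrentSet f) :
    ∃ i j, Arrow f (L i) (L j) := by
  obtain ⟨i, hi⟩ := h.exists_mem_unstableSet x
  obtain ⟨j, hj⟩ := h.exists_mem_stableSet x
  exact ⟨i, j, x, ⟨hi, hj⟩, hx⟩

theorem mem_of_forall_symm_iterate_mem (h : IsDecomposition f L) {c : Fin k}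
    (hc : ∀ j, ¬ Arrow f (L c) (L j)) {N : Set X} (hN : IsClosed N)
    (hNc : N ∩ generalizedRecurrentSet f ⊆ L c) {x : X} (hx : ∀ n : ℕ, f.symm^[n] x ∈ N) :
    x ∈ L c := by
  by_contra hxc
  have hxrec : x ∉ generalizedRecurrentSet f := fun hrec => hxc (hNc ⟨hx 0, hrec⟩)
  have hback : Tendsto (f.symm^[·] x) atTop (𝓝ˢ (L c)) :=
    hN.isCompact.tendsto_nhdsSet_of_mapClusterPt (Eventually.of_forall hx) fun y hyN hy =>
      hNc ⟨hyN, mem_generalizedRecurrentSet_of_mapClusterPt_symm hy⟩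
  obtain ⟨j, hj⟩ := h.exists_mem_stableSet x
  exact hc j ⟨x, ⟨(mem_unstableSet_iff_tendsto_nhdsSet (h.isCompact c)).2 hback, hj⟩, hxrec⟩

theorem isUniformlyAttracting_of_forall_not_arrow (h : IsDecomposition f L) {c : Fin k}
    (hc : ∀ j, ¬ Arrow f (L c) (L j)) : IsUniformlyAttracting f (L c) := by
  obtain ⟨N, hNL, hN, hNc⟩ := h.exists_isClosed_nhdsSet_inter_subset c
  exact isUniformlyAttracting_of_forall_symm_iterate_mem (h.mapsTo c) (h.mapsTo_symm c) hN hNL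
    fun _ => h.mem_of_forall_symm_iterate_mem hc hN hNc

end CompactMetric

end IsDecomposition

section Cycles

variable {α : Type*}

theorem periodicPts_nonempty [Finite α] [Nonempty α] (s : α → α) :
    (Function.periodicPts s).Nonempty := by
  obtain ⟨a⟩ := ‹Nonempty α›
  obtain ⟨m, n, hmn, heq⟩ : ∃ m n : ℕ, m < n ∧ s^[m] a = s^[n] a :=
    finite_univ.exists_lt_map_eq_of_forall_mem fun _ => mem_univ _
  refine ⟨s^[m] a, n - m, Nat.sub_pos_of_lt hmn, ?_⟩
  change s^[n - m] (s^[m] a) = s^[m] a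
  rw [← Function.iterate_add_apply, Nat.sub_add_cancel hmn.le, heq]

theorem injective_iterate_fin_minimalPeriod (s : α → α) (y : α) :
    Function.Injective fun j : Fin (Function.minimalPeriod s y) => s^[j] y :=
  fun i j hij => Fin.ext (Function.iterate_injOn_Iio_minimalPeriod i.2 j.2 hij)

theorem iterate_finRotate_minimalPeriod (s : α → α) (y : α)
    (j : Fin (Function.minimalPeriod s y)) :
    s^[finRotate (Function.minimalPeriod s y) j] y = s (s^[j] y) := by
  have := j.neZero
  rw [finRotate_apply, Fin.val_add, Fin.val_one', Nat.add_mod_mod,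
    Function.iterate_mod_minimalPeriod_eq, Function.iterate_succ_apply']

theorem exists_injective_cycle [Finite α] {R : α → α → Prop} (hR : ∀ a b, R a b → ∃ c, R b c)
    {a b : α} (hab : R a b) :
    ∃ (r : ℕ) (σ : Fin r → α), 1 ≤ r ∧ Function.Injective σ ∧ ∀ j, R (σ j) (σ (finRotate r j)) := by
  let S := {b : α // ∃ a, R a b}
  have hnext : ∀ x : S, ∃ y : S, R x y := by
    rintro ⟨x, w, hwx⟩
    obtain ⟨y, hxy⟩ := hR w x hwx
    exact ⟨⟨y, x, hxy⟩, hxy⟩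
  choose s hs using hnext
  have : Nonempty S := ⟨⟨b, a, hab⟩⟩
  obtain ⟨y, hy⟩ := periodicPts_nonempty s
  refine ⟨Function.minimalPeriod s y, fun j => s^[j] y,
    Function.minimalPeriod_pos_of_mem_periodicPts hy,
    Subtype.val_injective.comp (injective_iterate_fin_minimalPeriod s y), fun j => ?_⟩
  simpa only [iterate_finRotate_minimalPeriod] using hs (s^[j] y)

theorem HasNoCycles.exists_sink {X : Type*} [MetricSpace X] {f : X ≃ₜ X} {k : ℕ}
    {L : Fin k → Set X} (h : HasNoCycles f L) {a b : Fin k} (hab : Arrow f (L a) (L b)) :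
    ∃ i c, Arrow f (L i) (L c) ∧ ∀ j, ¬ Arrow f (L c) (L j) := by
  by_contra! hne
  obtain ⟨r, σ, hr, hσ, hcycle⟩ :=
    exists_injective_cycle (R := fun i j => Arrow f (L i) (L j)) hne hab
  exact h r σ hσ ⟨hr, hcycle⟩

end Cycles

end GenRec

theorem mainTheorem9_general (X : Type*) [MetricSpace X] [CompactSpace X] (f : X ≃ₜ X)
    (hf : ∃ u : X → ℝ, GenRec.IsContinuousStrictLyapunov f u)
    (hdec : ∃ (k : ℕ) (L : Fin k → Set X),
      GenRec.IsDecomposition f L ∧ GenRec.HasNoCycles f L) :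
    ∃ V ∈ 𝓝 f, ∀ g ∈ V, ∃ u : X → ℝ, GenRec.IsContinuousStrictLyapunov g u := by
  obtain ⟨u, hu, x, hx⟩ := hf
  obtain ⟨k, L, hL, hcyc⟩ := hdec
  obtain ⟨a, b, hab⟩ := hL.exists_arrow (hu.notMem_generalizedRecurrentSet hx)
  obtain ⟨i, c, hic, hsink⟩ := hcyc.exists_sink hab
  have hattr : GenRec.IsUniformlyAttracting f (L c) :=
    hL.isUniformlyAttracting_of_forall_not_arrow hsink
  exact eventually_iff_exists_mem.1
    (hattr.eventually_exists_isContinuousStrictLyapunov (hL.not_isOpen_of_arrow hic))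

theorem mainTheorem9 (n : ℕ) (hn : 2 ≤ n) (M : Type*) [MetricSpace M] [CompactSpace M]
    [ChartedSpace (EuclideanSpace ℝ (Fin n)) M] (f : M ≃ₜ M)
    (hf : ∃ u : M → ℝ, GenRec.IsContinuousStrictLyapunov f u)
    (hdec : ∃ (k : ℕ) (L : Fin k → Set M),
      GenRec.IsDecomposition f L ∧ GenRec.HasNoCycles f L) :
    ∃ V ∈ 𝓝 f, ∀ g ∈ V, ∃ u : M → ℝ, GenRec.IsContinuousStrictLyapunov g u :=
  mainTheorem9_general M f hf hdec
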